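/- Let $d\ge 2$, let $\mathcal L:\mathbb R^d\to\mathbb R$ be differentiable with $Z=\int e^{-\mathcal L(x)}\,dx<\infty$, and let $p(x)=e^{-\mathcal L(x)}/Z$. On the phase space $\mathbb R^d\times S^{d-1}$ of pairs $z=(x,u)$ let the target be $\pi(dz)=p(x)\,dx\otimes \mathcal U_{S^{d-1}}(du)$, with $\mathcal U_{S^{d-1}}$ the uniform distribution on the unit sphere. Fix a step size $\epsilon>0$ and a partial refreshment length $\ell>0$. For $\eta\in\mathbb R$ put $$e(x)=-\frac{\nabla\mathcal L(x)}{\|\nabla\mathcal L(x)\|},\qquad \delta_\eta(x)=\frac{\eta\,\|\nabla\mathcal L(x)\|}{d-1},\qquad g_\eta(x,u)=\cosh\delta_\eta(x)+(e(x)\cdot u)\sinh\delta_\eta(x)$$ (with $e(x)=0$ where $\nabla\mathcal L(x)=0$), and define $$A_\eta(x,u)=(x+\eta u,\,u),\qquad B_\eta(x,u)=\Bigl(x,\ \frac{u+\bigl(\sinh\delta_\eta(x)+(e(x)\cdot u)(\cosh\delta_\eta(x)-1)\bigr)e(x)}{g_\eta(x,u)}\Bigr),$$ $\Phi_\epsilon=B_{\epsilon/2}\circ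 A_\epsilon\circ B_{\epsilon/2}$ and $\mathcal T(x,u)=(x,-u)$. Let $O_\epsilon$ be the random update $$O_\epsilon(x,u)=\Bigl(x,\ \frac{c_1u+c_2\,\xi/\sqrt d}{\|c_1u+c_2\,\xi/\sqrt d\|}\Bigr),\qquad \xi\sim\mathcal N(0,I_d),\quad c_1=e^{-\epsilon/\ell},\quad c_2=\sqrt{1-c_1^2}.$$ Let $q(dz'\mid z)$ be the transition kernel of the one-step proposal $\mathcal T\circ O_\epsilon\circ\Phi_\epsilon\circ O_\epsilon$, with independent noise in the two $O_\epsilon$ updates. The energy error of the deterministic step $\Phi_\epsilon$ started from $(x,v)$ is the sum of the energy changes of its three updates, where the update $A_\epsilon$ from position $x$ to $x'$ contributes $-\log\frac{p(x')}{p(x)}$ and the update $B_{\epsilon/2}$ applied to $(y,w)$ contributes $(d-1)\log g_{\epsilon/2}(y,w)$. For $z=(x,u)$ and $z'=(x',u')$, let $\Delta(z',z)$ be the energy error of the deterministic step that starts from $(x,v)$ for a unit vector $v$ and ends at position $x'$, and set $\Delta(z',z)=0$ if there is no such step. Then $\Delta$ does not depend on the $O_\epsilon$ updates: for all $x\in\mathbb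 R^d$ and $u,v,w\in S^{d-1}$, if $\Phi_\epsilon(x,v)=(x',v')$, then $\Delta\bigl((x',w),(x,u)\bigr)$ equals the energy error of $\Phi_\epsilon$ started from $(x,v)$. Moreover, the measures $\pi(dz)\,q(dz'\mid z)$ and $\pi(dz')\,q(dz\mid z')$ on pairs $(z,z')$ are mutually absolutely continuous, and for $\pi(dz)\,q(dz'\mid z)$-almost every $(z,z')$ the Metropolis–Hastings ratio is $$\frac{\pi(dz')\,q(dz\mid z')}{\pi(dz)\,q(dz'\mid z)}=e^{-\Delta(z',z)},$$ so that the Metropolis–Hastings acceptance probability of the proposal is $\min\bigl(1,\,e^{-\Delta(z',z)}\bigr)$. -/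

import Mathlib

open MeasureTheory ProbabilityTheory Real
open scoped ENNReal

noncomputable section

namespace MAMS

/-- Position space `ℝ^d` with its Euclidean structure. -/
abbrev Pos (d : ℕ) := EuclideanSpace ℝ (Fin d)

/-- The unit sphere `S^{d-1}` of velocities. -/
abbrev Vel (d : ℕ) := Metric.sphere (0 : EuclideanSpace ℝ (Fin d)) 1

/-- Phase space: pairs `z = (x, u)` with `u` a unit vector. -/
abbrev Phase (d : ℕ) := Pos d × Vel d

variable {d : ℕ}

/-! ### Target distribution -/

/-- The normalized target density `p(x) = exp(-L(x)) / Z`, `Z = ∫ exp(-L)`. -/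
def targetDensity (L : Pos d → ℝ) (x : Pos d) : ℝ :=
  exp (-L x) / ∫ y, exp (-L y)

/-- The uniform probability distribution on the sphere `S^{d-1}`. -/
def uniformSphere (d : ℕ) : Measure (Vel d) :=
  ((volume : Measure (Pos d)).toSphere Set.univ)⁻¹ • (volume : Measure (Pos d)).toSphere

/-- The phase space target `p(x) dx ⊗ U_{S^{d-1}}(du)`. -/
def phaseTarget (L : Pos d → ℝ) : Measure (Phase d) :=
  ((volume : Measure (Pos d)).withDensity fun x => ENNReal.ofReal (targetDensity L x)).prod
    (uniformSphere d)

lemma isProbabilityMeasure_uniformSphere (hd : 1 ≤ d) :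
    IsProbabilityMeasure (uniformSphere d) := by
  constructor
  have : Nonempty (Fin d) := ⟨⟨0, hd⟩⟩
  have h0 : (volume : Measure (Pos d)).toSphere Set.univ ≠ 0 := by
    rw [Measure.toSphere_apply_univ]
    have := (Metric.measure_ball_pos (volume : Measure (Pos d)) 0 one_pos).ne'
    simp [this]
    omega
  rw [uniformSphere, Measure.smul_apply, smul_eq_mul]
  exact ENNReal.inv_mul_cancel h0 (measure_ne_top _ _)

lemma isProbabilityMeasure_phaseTarget (hd : 1 ≤ d) (L : Pos d → ℝ)
    (hint : Integrable fun x => exp (-L x)) : IsProbabilityMeasure (phaseTarget L) := by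
  have := isProbabilityMeasure_uniformSphere hd
  have : IsProbabilityMeasure
      ((volume : Measure (Pos d)).withDensity fun x => ENNReal.ofReal (targetDensity L x)) := by
    constructor
    rw [withDensity_apply _ MeasurableSet.univ, Measure.restrict_univ]
    have hpos : 0 < ∫ y, exp (-L y) := integral_exp_pos hint
    unfold targetDensity
    rw [← ofReal_integral_eq_lintegral_ofReal (hint.div_const _)
      (Filter.Eventually.of_forall fun x => by positivity), integral_div, div_self hpos.ne',
      ENNReal.ofReal_one]
  unfold phaseTarget
  infer_instance

/-! ### Deterministic updates -/

/-- `e(x) = -∇L(x) / ‖∇L(x)‖` (the zero vector where the gradient vanishes). -/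
def forceDir (L : Pos d → ℝ) (x : Pos d) : Pos d :=
  -(‖gradient L x‖⁻¹ • gradient L x)

/-- `δ = ε ‖∇L(x)‖ / (d - 1)`. -/
def forceStep (L : Pos d → ℝ) (ε : ℝ) (x : Pos d) : ℝ :=
  ε * ‖gradient L x‖ / ((d : ℝ) - 1)

/-- The factor `cosh δ + (e · u) sinh δ`. -/
def growth (L : Pos d → ℝ) (ε : ℝ) (x u : Pos d) : ℝ :=
  cosh (forceStep L ε x) + inner ℝ (forceDir L x) u * sinh (forceStep L ε x)

/-- The velocity update as a vector: the time-`ε` solution of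
`u' = -(I - u uᵀ) ∇L(x) / (d - 1)` at fixed `x`
(see `hasDerivAt_velocityUpdate` and `velocityUpdate_zero`). -/
def velocityUpdate (L : Pos d → ℝ) (ε : ℝ) (x u : Pos d) : Pos d :=
  (growth L ε x u)⁻¹ •
    (u + (sinh (forceStep L ε x) +
      inner ℝ (forceDir L x) u * (cosh (forceStep L ε x) - 1)) • forceDir L x)

lemma forceDir_cases (L : Pos d → ℝ) (x : Pos d) :
    ‖forceDir L x‖ = 1 ∨ (forceDir L x = 0 ∧ ‖gradient L x‖ = 0) := by
  by_cases h : gradient L x = 0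
  · right; simp [forceDir, h]
  · left
    have : ‖gradient L x‖ ≠ 0 := norm_ne_zero_iff.mpr h
    simp [forceDir, norm_smul, this]

lemma growth_pos (L : Pos d → ℝ) (ε : ℝ) (x u : Pos d) (hu : ‖u‖ = 1) :
    0 < growth L ε x u := by
  have hc : |inner ℝ (forceDir L x) u| ≤ 1 := by
    have h1 := abs_real_inner_le_norm (forceDir L x) u
    rw [hu, mul_one] at h1
    rcases forceDir_cases L x with h | ⟨h, -⟩
    · linarith
    · simp [h]
  have hs : |sinh (forceStep L ε x)| < cosh (forceStep L ε x) := by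
    rw [abs_lt]
    have h1 := exp_pos (forceStep L ε x)
    have h2 := exp_pos (-forceStep L ε x)
    rw [← cosh_add_sinh] at h1
    rw [← cosh_sub_sinh] at h2
    constructor <;> linarith
  have h3 : |inner ℝ (forceDir L x) u * sinh (forceStep L ε x)| < cosh (forceStep L ε x) := by
    rw [abs_mul]
    nlinarith [abs_nonneg (sinh (forceStep L ε x))]
  have := (abs_lt.mp h3).1
  unfold growth
  linarith

lemma norm_velocityUpdate (L : Pos d → ℝ) (ε : ℝ) (x u : Pos d) (hu : ‖u‖ = 1) :
    ‖velocityUpdate L ε x u‖ = 1 := by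
  have hg := growth_pos L ε x u hu
  have key : ‖u + (sinh (forceStep L ε x) +
      inner ℝ (forceDir L x) u * (cosh (forceStep L ε x) - 1)) • forceDir L x‖ ^ 2
      = growth L ε x u ^ 2 := by
    rw [norm_add_sq_real, norm_smul, mul_pow, inner_smul_right, real_inner_comm (forceDir L x) u, hu]
    rcases forceDir_cases L x with h | ⟨h, h'⟩
    · rw [h]
      simp only [Real.norm_eq_abs, sq_abs, growth]
      have := cosh_sq (forceStep L ε x)
      generalize cosh (forceStep L ε x) = k at *
      generalize sinh (forceStep L ε x) = s at *
      generalize (inner ℝ (forceDir L x) u : ℝ) = c at *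
      linear_combination (c ^ 2 - 1) * this
    · have : forceStep L ε x = 0 := by simp [forceStep, h']
      simp [h, growth, this]
  have key' := (sq_eq_sq₀ (norm_nonneg _) hg.le).mp key
  rw [velocityUpdate, norm_smul, key', norm_inv, Real.norm_eq_abs, abs_of_pos hg]
  exact inv_mul_cancel₀ hg.ne'

lemma velocityUpdate_zero (L : Pos d → ℝ) (x u : Pos d) : velocityUpdate L 0 x u = u := by
  simp [velocityUpdate, growth, forceStep]

lemma hasDerivAt_velocityUpdate (L : Pos d → ℝ) (x u : Pos d) (hu : ‖u‖ = 1) (t : ℝ) :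
    HasDerivAt (fun s => velocityUpdate L s x u)
      (-(((d : ℝ) - 1)⁻¹ • (gradient L x -
        inner ℝ (velocityUpdate L t x u) (gradient L x) • velocityUpdate L t x u))) t := by
  have hG := (growth_pos L t x u hu).ne'
  have hgrad : gradient L x = -(‖gradient L x‖ • forceDir L x) := by
    by_cases h : gradient L x = 0
    · simp [h]
    · simp [forceDir, smul_smul, norm_ne_zero_iff.mpr h]
  have hd : HasDerivAt (fun s => forceStep L s x) (‖gradient L x‖ / ((d : ℝ) - 1)) t := by
    simpa [forceStep, mul_div_assoc] using
      (hasDerivAt_id t).mul_const (‖gradient L x‖ / ((d : ℝ) - 1))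
  have hden : HasDerivAt (fun s => growth L s x u) _ t :=
    hd.cosh.add (hd.sinh.const_mul (inner ℝ (forceDir L x) u))
  have hnum := ((hd.sinh.add ((hd.cosh.sub_const 1).const_mul
    (inner ℝ (forceDir L x) u))).smul_const (forceDir L x)).const_add u
  have h := (hden.inv hG).smul hnum
  refine h.congr_deriv ?_
  have hin : ‖gradient L x‖ * inner ℝ (velocityUpdate L t x u) (forceDir L x) =
      ‖gradient L x‖ * ((growth L t x u)⁻¹ * (sinh (forceStep L t x) +
        inner ℝ (forceDir L x) u * cosh (forceStep L t x))) := by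
    rcases forceDir_cases L x with h | ⟨-, h⟩
    · congr 1
      rw [velocityUpdate, real_inner_smul_left, inner_add_left, real_inner_smul_left,
        real_inner_self_eq_norm_sq, h, real_inner_comm]
      ring
    · simp [h]
  have hrhs : inner ℝ (velocityUpdate L t x u) (gradient L x) =
      -(‖gradient L x‖ * inner ℝ (velocityUpdate L t x u) (forceDir L x)) := by
    conv_lhs => rw [hgrad]
    rw [inner_neg_right, real_inner_smul_right]
  rw [hrhs, hin]
  generalize hg' : ‖gradient L x‖ = γ at *
  rw [hgrad, velocityUpdate]
  have hGd : growth L t x u = cosh (forceStep L t x) +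
    inner ℝ (forceDir L x) u * sinh (forceStep L t x) := rfl
  simp only [Pi.inv_apply, Pi.add_apply]
  generalize growth L t x u = G at *
  generalize forceDir L x = e at *
  generalize cosh (forceStep L t x) = k at *
  generalize sinh (forceStep L t x) = s at *
  match_scalars
  · simp only [mul_one, div_eq_mul_inv]
    linear_combination (-(γ * ((d : ℝ) - 1)⁻¹ * G⁻¹)) * hGd +
      (γ * ((d : ℝ) - 1)⁻¹) * inv_mul_cancel₀ hG
  · simp only [mul_one, div_eq_mul_inv]
    ring

/-- Position update `A_ε(x, u) = (x + ε u, u)`. -/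
def updateA (ε : ℝ) (z : Phase d) : Phase d := (z.1 + ε • (z.2 : Pos d), z.2)

/-- Velocity update `B_ε` on phase space. -/
def updateB (L : Pos d → ℝ) (ε : ℝ) (z : Phase d) : Phase d :=
  (z.1, ⟨velocityUpdate L ε z.1 z.2, by
    simpa using norm_velocityUpdate L ε z.1 z.2 (by simp)⟩)

/-- The deterministic step `Φ_ε = B_{ε/2} ∘ A_ε ∘ B_{ε/2}`. -/
def stepBAB (L : Pos d → ℝ) (ε : ℝ) : Phase d → Phase d :=
  updateB L (ε / 2) ∘ updateA ε ∘ updateB L (ε / 2)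

/-- Time reversal `𝒯(x, u) = (x, -u)`. -/
def timeReversal (z : Phase d) : Phase d := (z.1, -z.2)

/-! ### Energy error -/

/-- Potential energy change `-log (p(x') / p(x))` of the position update started from `z`. -/
def deltaV (L : Pos d → ℝ) (ε : ℝ) (z : Phase d) : ℝ :=
  -log (targetDensity L (updateA ε z).1 / targetDensity L z.1)

/-- Kinetic energy change `(d - 1) log (cosh δ + (e · u) sinh δ)` of the velocity update
started from `z`. -/
def deltaK (L : Pos d → ℝ) (ε : ℝ) (z : Phase d) : ℝ :=
  ((d : ℝ) - 1) * log (growth L ε z.1 z.2)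

/-- Total energy change of the deterministic step `B_{ε/2} ∘ A_ε ∘ B_{ε/2}` started from `z`. -/
def stepEnergyError (L : Pos d → ℝ) (ε : ℝ) (z : Phase d) : ℝ :=
  deltaK L (ε / 2) z
    + deltaV L ε (updateB L (ε / 2) z)
    + deltaK L (ε / 2) (updateA ε (updateB L (ε / 2) z))

open Classical in
/-- `Δ(z', z)`: the energy error of the deterministic part of a transition from `z = (x, u)` to
`z' = (x', u')`, i.e. of a step `Φ_ε` that starts at `(x, v)` for some unit velocity `v` and ends
at position `x'` (for `ε ≠ 0` there is at most one such `v`). It is set to `0` if `x'` cannot be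
reached from `x`. -/
def energyError (L : Pos d → ℝ) (ε : ℝ) (z' z : Phase d) : ℝ :=
  if h : ∃ v : Vel d, (stepBAB L ε (z.1, v)).1 = z'.1 then
    stepEnergyError L ε (z.1, h.choose)
  else 0

/-! ### Partial velocity refreshment -/

/-- `w / ‖w‖` as a point of the sphere; the point `u₀` is returned for `w = 0`. -/
def normalizeOr (u₀ : Vel d) (w : Pos d) : Vel d :=
  if h : w = 0 then u₀ else ⟨‖w‖⁻¹ • w, by
    simp [norm_smul, norm_ne_zero_iff.mpr h]⟩

/-- The refreshed velocity
`O_ε(u) = (c₁ u + c₂ ξ / √d) / ‖c₁ u + c₂ ξ / √d‖` for the noise value `ξ`, where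
`c₁ = exp(-ε / ℓ)`, `c₂ = √(1 - c₁²)` and `ℓ` is the partial refreshment length. -/
def refresh (ε ℓ : ℝ) (p : Phase d × Pos d) : Phase d :=
  (p.1.1, normalizeOr p.1.2
    (exp (-ε / ℓ) • (p.1.2 : Pos d) + (√(1 - exp (-ε / ℓ) ^ 2) / √(d : ℝ)) • p.2))

/-! ### Measurability -/

lemma measurable_gradient (L : Pos d → ℝ) : Measurable (gradient L) :=
  (InnerProductSpace.toDual ℝ (Pos d)).symm.continuous.measurable.comp (measurable_fderiv ℝ L)

lemma measurable_updateA (ε : ℝ) : Measurable (updateA (d := d) ε) := by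
  unfold updateA; fun_prop

lemma measurable_updateB (L : Pos d → ℝ) (ε : ℝ) : Measurable (updateB L ε) := by
  have hg := measurable_gradient L
  refine measurable_fst.prodMk (Measurable.subtype_mk ?_)
  unfold velocityUpdate growth forceStep forceDir
  fun_prop

lemma measurable_stepBAB (L : Pos d → ℝ) (ε : ℝ) : Measurable (stepBAB L ε) :=
  (measurable_updateB L _).comp ((measurable_updateA ε).comp (measurable_updateB L _))

lemma measurable_timeReversal : Measurable (timeReversal (d := d)) := by
  refine measurable_fst.prodMk ?_
  exact (continuous_neg.measurable).comp measurable_snd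

lemma measurable_refresh (ε ℓ : ℝ) : Measurable (refresh (d := d) ε ℓ) := by
  refine (measurable_fst.comp measurable_fst).prodMk ?_
  have hw : Measurable fun p : Phase d × Pos d =>
      exp (-ε / ℓ) • (p.1.2 : Pos d) + (√(1 - exp (-ε / ℓ) ^ 2) / √(d : ℝ)) • p.2 := by
    fun_prop
  have hval : ∀ p : Phase d × Pos d, ((refresh ε ℓ p).2 : Pos d) =
      if exp (-ε / ℓ) • (p.1.2 : Pos d) + (√(1 - exp (-ε / ℓ) ^ 2) / √(d : ℝ)) • p.2 = 0
      then (p.1.2 : Pos d)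
      else ‖exp (-ε / ℓ) • (p.1.2 : Pos d) + (√(1 - exp (-ε / ℓ) ^ 2) / √(d : ℝ)) • p.2‖⁻¹ •
        (exp (-ε / ℓ) • (p.1.2 : Pos d) + (√(1 - exp (-ε / ℓ) ^ 2) / √(d : ℝ)) • p.2) := by
    intro p
    simp only [refresh, normalizeOr]
    split_ifs <;> rfl
  rw [← (MeasurableEmbedding.subtype_coe
    (Metric.isClosed_sphere.measurableSet : MeasurableSet (Metric.sphere (0 : Pos d) 1))).measurable_comp_iff]
  change Measurable fun p : Phase d × Pos d => ((refresh ε ℓ p).2 : Pos d)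
  simp only [hval]
  exact Measurable.ite (hw (measurableSet_singleton 0)) (by fun_prop) (by fun_prop)

/-! ### Proposal kernel -/

/-- The transition kernel of the `O` update, driven by a standard Gaussian vector on `ℝ^d`. -/
def refreshKernel (d : ℕ) (ε ℓ : ℝ) : Kernel (Phase d) (Phase d) :=
  (Kernel.id ×ₖ Kernel.const (Phase d) (stdGaussian (Pos d))).map (refresh ε ℓ)

instance isMarkovKernel_refreshKernel (ε ℓ : ℝ) : IsMarkovKernel (refreshKernel d ε ℓ) :=
  Kernel.IsMarkovKernel.map _ (measurable_refresh ε ℓ)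

/-- The one-step proposal kernel `q` of `𝒯 ∘ O ∘ B ∘ A ∘ B ∘ O`, with independent noise in the
two `O` updates. -/
def proposal (L : Pos d → ℝ) (ε ℓ : ℝ) : Kernel (Phase d) (Phase d) :=
  Kernel.deterministic timeReversal measurable_timeReversal ∘ₖ
    (refreshKernel d ε ℓ ∘ₖ
      (Kernel.deterministic (stepBAB L ε) (measurable_stepBAB L ε) ∘ₖ refreshKernel d ε ℓ))

instance isMarkovKernel_proposal (L : Pos d → ℝ) (ε ℓ : ℝ) :
    IsMarkovKernel (proposal L ε ℓ) := by
  unfold proposal; infer_instance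

/-! ### Metropolis–Hastings -/

section MetropolisHastings

variable {α : Type*} [MeasurableSpace α]

/-- The joint law `p(dz) q(dz' | z)` of a pair (current state, proposed state). -/
def forwardLaw (p : Measure α) (q : Kernel α α) : Measure (α × α) := p ⊗ₘ q

/-- The law `p(dz') q(dz | z')`, read as a measure in `(z, z')`. -/
def backwardLaw (p : Measure α) (q : Kernel α α) : Measure (α × α) :=
  (p ⊗ₘ q).map Prod.swap

/-- The Metropolis–Hastings ratio `p(z') q(z | z') / (p(z) q(z' | z))`, as the Radon–Nikodym
derivative of the backward law with respect to the forward law at `(z, z')`. If `p` and `q` have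
densities with respect to a common reference measure, this is almost everywhere the quotient of
the densities. -/
def mhRatio (p : Measure α) (q : Kernel α α) (z' z : α) : ℝ≥0∞ :=
  (backwardLaw p q).rnDeriv (forwardLaw p q) (z, z')

/-- The Metropolis–Hastings acceptance probability of a move from `z` to `z'`. -/
def acceptProb (p : Measure α) (q : Kernel α α) (z' z : α) : ℝ≥0∞ :=
  min 1 (mhRatio p q z' z)

end MetropolisHastings

end MAMS

end

noncomputable section

namespace MAMS

variable {d : ℕ}

/-! ### Density of the standard Gaussian -/

/-! Let `m` be Lebesgue measure times the uniform distribution on the sphere (`phaseVolume`). The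
proposal kernel has no density with respect to `m`, since `‖x' - x‖ = ε` always holds; so the two
joint laws are compared directly, by integrating test functions.

The update `O` fixes the position and is reversible for `m` (`lintegral_refresh_symm`), because the
direction of `c u + s ξ` has a density depending only on the inner product of the old and new
velocities. Hence the forward law can be written from the state `v` after the first refreshment: it
is the law of `(O v, 𝒯 O Φ v)` with `v` weighted by `p(x) dm` (`lintegral_forwardLaw`).

Since `Φ 𝒯 Φ = 𝒯` and `𝒯` commutes with `O` in law, the substitution `v ↦ 𝒯 Φ v` exchanges the two
ends of the pair. It replaces the weight `p` by `p ∘ Φ` times the Jacobian of `Φ`, which is `p ·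
exp(-energy error)`: each `B` has Jacobian `g^{-(d-1)}` (`lintegral_sphereUpdate`), while `A` and
`𝒯` preserve `m`.

The energy error is a function of the pair alone: the displacement `x' - x` is `ε` times the
velocity after the first `B`, and `B` is invertible (`energyError_stepBAB`). So the backward law is
the forward law times the positive density `exp(-Δ)`. -/

lemma pi_gaussianReal_eq_withDensity (ι : Type*) [Fintype ι] :
    Measure.pi (fun _ : ι => gaussianReal 0 1) =
      (volume : Measure (ι → ℝ)).withDensity
        fun x => ENNReal.ofReal (∏ i, gaussianPDFReal 0 1 (x i)) := by
  refine Measure.pi_eq fun s hs => ?_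
  have hint : ∀ i, Integrable ((s i).indicator (gaussianPDFReal 0 1)) :=
    fun i => (integrable_gaussianPDFReal 0 1).indicator (hs i)
  have hnn : ∀ i y, 0 ≤ (s i).indicator (gaussianPDFReal 0 1) y :=
    fun i y => Set.indicator_nonneg (fun _ _ => gaussianPDFReal_nonneg 0 1 _) y
  rw [withDensity_apply _ (MeasurableSet.univ_pi hs),
    ← lintegral_indicator (MeasurableSet.univ_pi hs)]
  have h1 : ∀ x : ι → ℝ, (Set.univ.pi s).indicator
      (fun x => ENNReal.ofReal (∏ i, gaussianPDFReal 0 1 (x i))) x =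
      ENNReal.ofReal (∏ i, (s i).indicator (gaussianPDFReal 0 1) (x i)) := by
    intro x
    by_cases hx : x ∈ Set.univ.pi s
    · rw [Set.indicator_of_mem hx]
      congr 1
      exact Finset.prod_congr rfl fun i _ => by
        rw [Set.indicator_of_mem (hx i (Set.mem_univ i))]
    · rw [Set.indicator_of_notMem hx]
      simp only [Set.mem_pi, Set.mem_univ, forall_const, not_forall] at hx
      obtain ⟨i, hi⟩ := hx
      rw [Finset.prod_eq_zero (Finset.mem_univ i) (Set.indicator_of_notMem hi _),
        ENNReal.ofReal_zero]
  simp_rw [h1]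
  rw [← ofReal_integral_eq_lintegral_ofReal, volume_pi,
    integral_fintype_prod_eq_prod (f := fun i => (s i).indicator (gaussianPDFReal 0 1)),
    ENNReal.ofReal_prod_of_nonneg fun i _ => integral_nonneg (hnn i)]
  · refine Finset.prod_congr rfl fun i _ => ?_
    rw [gaussianReal_apply 0 one_ne_zero, integral_indicator (hs i)]
    rw [ofReal_integral_eq_lintegral_ofReal (integrable_gaussianPDFReal 0 1).integrableOn
      (Filter.Eventually.of_forall fun _ => gaussianPDFReal_nonneg 0 1 _)]
    rfl
  · exact Integrable.fintype_prod hint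
  · exact Filter.Eventually.of_forall fun x => Finset.prod_nonneg fun i _ => hnn i _

lemma lintegral_stdGaussian (h : Pos d → ℝ≥0∞) (hh : Measurable h) :
    ∫⁻ x, h x ∂(stdGaussian (Pos d)) =
      ∫⁻ x, ENNReal.ofReal ((√(2 * π))⁻¹ ^ d * exp (-‖x‖ ^ 2 / 2)) * h x := by
  rw [← map_pi_eq_stdGaussian, lintegral_map hh (by fun_prop), pi_gaussianReal_eq_withDensity,
    lintegral_withDensity_eq_lintegral_mul _ (by fun_prop) (by fun_prop),
    ← (PiLp.volume_preserving_toLp (Fin d)).lintegral_comp (by fun_prop)]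
  refine lintegral_congr fun x => ?_
  simp only [Pi.mul_apply]
  congr 2
  rw [EuclideanSpace.real_norm_sq_eq]
  simp [gaussianPDFReal, Finset.prod_mul_distrib, ← exp_sum, Finset.sum_div, neg_div]

lemma lintegral_stdGaussian_neg (h : Pos d → ℝ≥0∞) (hh : Measurable h) :
    ∫⁻ x, h (-x) ∂(stdGaussian (Pos d)) = ∫⁻ x, h x ∂(stdGaussian (Pos d)) := by
  conv_rhs => rw [← stdGaussian_map (LinearIsometryEquiv.neg ℝ (E := Pos d))]
  rw [lintegral_map hh (by fun_prop)]
  rfl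

/-! ### Polar coordinates -/

/-- The origin is a null set, and the punctured space is the sphere times `(0, ∞)`, with
`volumeIoiPow (d - 1)` carrying the weight `r ^ (d - 1)`. -/
lemma lintegral_polar (h : Pos d → ℝ≥0∞) (hh : Measurable h) (hd : 1 ≤ d) :
    ∫⁻ w, h w = ∫⁻ u : Vel d, ∫⁻ r : Set.Ioi (0 : ℝ), h (r.1 • (u : Pos d))
      ∂(Measure.volumeIoiPow (d - 1)) ∂(volume : Measure (Pos d)).toSphere := by
  have : Nonempty (Fin d) := ⟨⟨0, hd⟩⟩
  have hm := (volume : Measure (Pos d)).measurePreserving_homeomorphUnitSphereProd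
  rw [finrank_euclideanSpace_fin] at hm
  rw [← lintegral_prod (fun p : Vel d × Set.Ioi (0 : ℝ) => h (p.2.1 • (p.1 : Pos d)))
    (by fun_prop), ← hm.lintegral_comp (by fun_prop)]
  have hval : ∀ w : ({0}ᶜ : Set (Pos d)), ((homeomorphUnitSphereProd (Pos d) w).2.1 •
      ((homeomorphUnitSphereProd (Pos d) w).1 : Pos d)) = w := fun w =>
    (homeomorphUnitSphereProd_symm_apply_coe (Pos d) _).symm.trans
      (by rw [Homeomorph.symm_apply_apply])
  simp_rw [hval]
  rw [lintegral_subtype_comap (measurableSet_singleton _).compl, restrict_compl_singleton]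

/-- The probability `uniformSphere d` and the surface measure differ by a scalar. -/
lemma lintegral_uniformSphere (f : Vel d → ℝ≥0∞) :
    ∫⁻ u, f u ∂(uniformSphere d) =
      ((volume : Measure (Pos d)).toSphere Set.univ)⁻¹ *
        ∫⁻ u, f u ∂(volume : Measure (Pos d)).toSphere := by
  rw [uniformSphere, lintegral_smul_measure, smul_eq_mul]

/-! ### The velocity update as the projection of a linear-growth map of `ℝ^d` -/

/-- The extension of the velocity update to a positively homogeneous map of `ℝ^d`: the spatial part
of the Lorentz boost of the null vector `(‖w‖, w)` with rapidity `δ` in the direction `e(x)`. -/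
def boost (L : Pos d → ℝ) (ε : ℝ) (x w : Pos d) : Pos d :=
  w + (‖w‖ * sinh (forceStep L ε x) +
    inner ℝ (forceDir L x) w * (cosh (forceStep L ε x) - 1)) • forceDir L x

lemma forceStep_neg (L : Pos d → ℝ) (ε : ℝ) (x : Pos d) :
    forceStep L (-ε) x = -forceStep L ε x := by
  simp [forceStep, neg_div]

lemma growth_neg (L : Pos d → ℝ) (ε : ℝ) (x u : Pos d) :
    growth L ε x (-u) = growth L (-ε) x u := by
  simp [growth, forceStep_neg]

lemma velocityUpdate_neg (L : Pos d → ℝ) (ε : ℝ) (x u : Pos d) :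
    velocityUpdate L ε x (-u) = -velocityUpdate L (-ε) x u := by
  rw [velocityUpdate, growth_neg, velocityUpdate, ← smul_neg]
  congr 1
  simp only [forceStep_neg, inner_neg_right, sinh_neg, cosh_neg]
  module

lemma boost_smul (L : Pos d → ℝ) (ε : ℝ) (x u : Pos d) {r : ℝ} (hr : 0 ≤ r) :
    boost L ε x (r • u) = r • boost L ε x u := by
  simp only [boost, norm_smul, inner_smul_right, Real.norm_eq_abs, abs_of_nonneg hr]
  module

/-- The velocity update is the radial projection of `boost`, and `growth` is the stretching factor
lost in projecting. -/
lemma boost_of_norm_eq_one (L : Pos d → ℝ) (ε : ℝ) (x u : Pos d) (hu : ‖u‖ = 1) :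
    boost L ε x u = growth L ε x u • velocityUpdate L ε x u := by
  rw [velocityUpdate, smul_smul, mul_inv_cancel₀ (growth_pos L ε x u hu).ne', one_smul, boost, hu,
    one_mul]

/-- A Lorentz boost keeps null vectors null, so the length of the spatial part is the boosted time
component. Homogeneity reduces this to unit vectors. -/
lemma norm_boost (L : Pos d → ℝ) (ε : ℝ) (x w : Pos d) :
    ‖boost L ε x w‖ =
      ‖w‖ * cosh (forceStep L ε x) + inner ℝ (forceDir L x) w * sinh (forceStep L ε x) := by
  rcases eq_or_ne w 0 with rfl | hw
  · simp [boost]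
  have hn : ‖w‖ ≠ 0 := norm_ne_zero_iff.mpr hw
  have hu : ‖‖w‖⁻¹ • w‖ = 1 := by simp [norm_smul, hn]
  have hwu : w = ‖w‖ • ‖w‖⁻¹ • w := by rw [smul_smul, mul_inv_cancel₀ hn, one_smul]
  conv_lhs => rw [hwu]
  rw [boost_smul _ _ _ _ (norm_nonneg w), boost_of_norm_eq_one _ _ _ _ hu, norm_smul, norm_smul,
    norm_velocityUpdate _ _ _ _ hu, norm_norm, Real.norm_eq_abs,
    abs_of_pos (growth_pos _ _ _ _ hu), growth, inner_smul_right]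
  field_simp

lemma boost_neg_boost (L : Pos d → ℝ) (ε : ℝ) (x w : Pos d) :
    boost L (-ε) x (boost L ε x w) = w := by
  rw [boost, norm_boost, forceStep_neg, sinh_neg, cosh_neg]
  rcases forceDir_cases L x with h | ⟨h, -⟩
  · rw [boost, inner_add_right, inner_smul_right, real_inner_self_eq_norm_sq, h, add_assoc,
      ← add_smul]
    -- The total coefficient of `forceDir L x` must vanish; this is `cosh² - sinh² = 1`.
    convert add_zero w
    convert zero_smul ℝ (forceDir L x)
    linear_combination (inner ℝ (forceDir L x) w) * cosh_sq (forceStep L ε x)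
  · simp [boost, h]

/-- Opposite boosts cancel, so the composite is `u` up to a positive factor; comparing norms shows
that this factor, the product of the two growths, is `1`. -/
lemma velocityUpdate_neg_velocityUpdate (L : Pos d → ℝ) (ε : ℝ) (x u : Pos d) (hu : ‖u‖ = 1) :
    velocityUpdate L (-ε) x (velocityUpdate L ε x u) = u := by
  have hv := norm_velocityUpdate L ε x u hu
  have hg := growth_pos L ε x u hu
  have hg' := growth_pos L (-ε) x _ hv
  have h := boost_neg_boost L ε x u
  rw [boost_of_norm_eq_one L ε x u hu, boost_smul _ _ _ _ hg.le,
    boost_of_norm_eq_one _ _ _ _ hv, smul_smul] at h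
  have hn := congrArg norm h
  rw [norm_smul, norm_velocityUpdate _ _ _ _ hv, hu, mul_one, Real.norm_eq_abs,
    abs_of_pos (mul_pos hg hg')] at hn
  rwa [hn, one_smul] at h

/-- The derivative of `boost` away from the origin. -/
def boostDeriv (L : Pos d → ℝ) (ε : ℝ) (x w : Pos d) : Pos d →L[ℝ] Pos d :=
  ContinuousLinearMap.id ℝ (Pos d) +
    ((sinh (forceStep L ε x) * ‖w‖⁻¹) • innerSL ℝ w +
      (cosh (forceStep L ε x) - 1) • innerSL ℝ (forceDir L x)).smulRight (forceDir L x)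

lemma hasFDerivAt_boost (L : Pos d → ℝ) (ε : ℝ) (x w : Pos d) (hw : w ≠ 0) :
    HasFDerivAt (boost L ε x) (boostDeriv L ε x w) w := by
  have hn : HasFDerivAt (fun w : Pos d => ‖w‖) (‖w‖⁻¹ • innerSL ℝ w) w := by
    have h := (hasStrictFDerivAt_norm_sq w).hasFDerivAt.sqrt (by simpa using hw)
    simp only [sqrt_sq (norm_nonneg _)] at h
    refine h.congr_fderiv ?_
    ext v
    simp
    ring
  have hi : HasFDerivAt (fun w : Pos d => inner ℝ (forceDir L x) w)
      (innerSL ℝ (forceDir L x)) w := (innerSL ℝ (forceDir L x)).hasFDerivAt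
  refine ((hasFDerivAt_id w).add (((hn.mul_const _).add (hi.mul_const _)).smul_const
    (forceDir L x))).congr_fderiv ?_
  rw [boostDeriv, smul_smul]

/-- The derivative is the identity plus a rank-one map `v ↦ φ(v) e`, whose determinant is `1 +
φ(e)`. Where the gradient vanishes, both sides are `1`. -/
lemma det_boostDeriv (L : Pos d → ℝ) (ε : ℝ) (x w : Pos d) (hw : w ≠ 0) :
    (boostDeriv L ε x w).det = ‖boost L ε x w‖ / ‖w‖ := by
  have h : ((boostDeriv L ε x w : Pos d →L[ℝ] Pos d) : Pos d →ₗ[ℝ] Pos d) =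
      LinearMap.transvection
        (((sinh (forceStep L ε x) * ‖w‖⁻¹) • innerSL ℝ w +
          (cosh (forceStep L ε x) - 1) • innerSL ℝ (forceDir L x) : Pos d →L[ℝ] ℝ) :
            Pos d →ₗ[ℝ] ℝ) (forceDir L x) := by
    ext v
    simp [boostDeriv, LinearMap.transvection]
  have hn : ‖w‖ ≠ 0 := norm_ne_zero_iff.mpr hw
  rw [ContinuousLinearMap.det, h, LinearMap.transvection.det, norm_boost,
    real_inner_comm w (forceDir L x)]
  simp only [ContinuousLinearMap.coe_coe, add_apply,
    smul_apply, innerSL_apply_apply, smul_eq_mul, real_inner_self_eq_norm_sq]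
  rcases forceDir_cases L x with h | ⟨h, h'⟩
  · rw [h]
    field_simp
    ring
  · have : forceStep L ε x = 0 := by simp [forceStep, h']
    simp [this, h, hn]

lemma boost_ne_zero (L : Pos d → ℝ) (ε : ℝ) (x w : Pos d) (hw : w ≠ 0) : boost L ε x w ≠ 0 := by
  intro h
  apply hw
  rw [← boost_neg_boost L ε x w, h]
  simp [boost]

/-- Change of variables for a bijection of the punctured space, the inverse being the boost of
opposite rapidity. The origin, where the norm is not differentiable, is null. -/
lemma lintegral_boost (L : Pos d → ℝ) (ε : ℝ) (x : Pos d) (hd : 1 ≤ d) (h : Pos d → ℝ≥0∞) :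
    ∫⁻ w, ENNReal.ofReal (‖boost L ε x w‖ / ‖w‖) * h (boost L ε x w) = ∫⁻ w, h w := by
  have : Nonempty (Fin d) := ⟨⟨0, hd⟩⟩
  have himg : boost L ε x '' {0}ᶜ = {0}ᶜ := by
    ext w
    constructor
    · rintro ⟨v, hv, rfl⟩
      exact boost_ne_zero L ε x v hv
    · intro hw
      refine ⟨boost L (-ε) x w, boost_ne_zero L _ x w hw, ?_⟩
      simpa using boost_neg_boost L (-ε) x w
  have hinj : Function.Injective (boost L ε x) :=
    Function.LeftInverse.injective (boost_neg_boost L ε x)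
  have key := lintegral_image_eq_lintegral_abs_det_fderiv_mul volume
    (measurableSet_singleton (0 : Pos d)).compl
    (fun w hw => (hasFDerivAt_boost L ε x w hw).hasFDerivWithinAt) hinj.injOn h
  rw [himg, restrict_compl_singleton] at key
  rw [key]
  conv_rhs => rw [← restrict_compl_singleton (μ := volume) (0 : Pos d)]
  conv_lhs => rw [← restrict_compl_singleton (μ := volume) (0 : Pos d)]
  refine setLIntegral_congr_fun (measurableSet_singleton (0 : Pos d)).compl fun w hw => ?_
  rw [det_boostDeriv L ε x w hw, abs_of_nonneg (by positivity)]

/-! ### Integration over the sphere by radial extension to the unit ball -/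

lemma measurable_normalizeOr (u₀ : Vel d) : Measurable (normalizeOr u₀) := by
  have hval : ∀ w : Pos d, (normalizeOr u₀ w : Pos d) =
      if w = 0 then (u₀ : Pos d) else ‖w‖⁻¹ • w := by
    intro w
    simp only [normalizeOr]
    split_ifs <;> rfl
  rw [← (MeasurableEmbedding.subtype_coe (Metric.isClosed_sphere.measurableSet :
    MeasurableSet (Metric.sphere (0 : Pos d) 1))).measurable_comp_iff]
  change Measurable fun w : Pos d => (normalizeOr u₀ w : Pos d)
  simp only [hval]
  exact Measurable.ite (measurableSet_singleton 0) (by fun_prop) (by fun_prop)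

lemma normalizeOr_smul (u₀ u : Vel d) {r : ℝ} (hr : 0 < r) :
    normalizeOr u₀ (r • (u : Pos d)) = u := by
  have hu : (u : Pos d) ≠ 0 := by
    rw [← norm_ne_zero_iff, norm_eq_of_mem_sphere]; exact one_ne_zero
  rw [normalizeOr, dif_neg (smul_ne_zero hr.ne' hu)]
  ext1
  simp [norm_smul, abs_of_pos hr, smul_smul, hr.ne']

lemma lintegral_volumeIoiPow_indicator (hd : 1 ≤ d) {a : ℝ} (ha : 0 < a) :
    ∫⁻ r : Set.Ioi (0 : ℝ), {r : Set.Ioi (0 : ℝ) | r.1 < a}.indicator 1 r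
      ∂(Measure.volumeIoiPow (d - 1)) = ENNReal.ofReal (a ^ d / d) := by
  have hd1 : d - 1 + 1 = d := by omega
  have hset : {r : Set.Ioi (0 : ℝ) | r.1 < a} = Set.Iio ⟨a, ha⟩ := rfl
  rw [hset, lintegral_indicator_one measurableSet_Iio, Measure.volumeIoiPow_apply_Iio, hd1]
  congr 2
  exact_mod_cast hd1

/-- Integration against the surface measure, as an integral over the unit ball. -/
lemma lintegral_ball_normalizeOr (hd : 1 ≤ d) (u₀ : Vel d) (f : Vel d → ℝ≥0∞)
    (hf : Measurable f) :
    ∫⁻ w, f (normalizeOr u₀ w) * (Metric.ball 0 1).indicator 1 w =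
      (∫⁻ u, f u ∂(volume : Measure (Pos d)).toSphere) * ENNReal.ofReal (d : ℝ)⁻¹ := by
  rw [lintegral_polar (fun w => f (normalizeOr u₀ w) * (Metric.ball 0 1).indicator 1 w)
    ((hf.comp (measurable_normalizeOr u₀)).mul
      (measurable_one.indicator Metric.isOpen_ball.measurableSet)) hd,
    ← lintegral_mul_const' _ _ ENNReal.ofReal_ne_top]
  refine lintegral_congr fun u => ?_
  -- On each ray the integrand is constant up to radius `1`, and `∫₀¹ r ^ (d - 1) dr = 1 / d`.
  have : ∀ r : Set.Ioi (0 : ℝ), f (normalizeOr u₀ (r.1 • (u : Pos d))) *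
      (Metric.ball 0 1).indicator 1 (r.1 • (u : Pos d)) =
      f u * {r : Set.Ioi (0 : ℝ) | r.1 < 1}.indicator 1 r := by
    intro r
    have hr : (0 : ℝ) < r.1 := r.2
    simp only [normalizeOr_smul u₀ u hr]
    congr 1
    simp only [Set.indicator, Metric.mem_ball, dist_zero_right, norm_smul, Real.norm_eq_abs,
      abs_of_pos hr, norm_eq_of_mem_sphere, mul_one, Set.mem_ofPred_eq, Pi.one_apply]
  simp_rw [this]
  rw [lintegral_const_mul _ (measurable_one.indicator
    (measurableSet_lt measurable_subtype_coe measurable_const)),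
    lintegral_volumeIoiPow_indicator hd one_pos, one_pow, one_div]

lemma nonempty_vel (hd : 1 ≤ d) : Nonempty (Vel d) := by
  have : Nonempty (Fin d) := ⟨⟨0, hd⟩⟩
  exact (NormedSpace.sphere_nonempty.mpr zero_le_one).to_subtype

lemma normalizeOr_neg (u₀ : Vel d) (w : Pos d) : normalizeOr (-u₀) (-w) = -normalizeOr u₀ w := by
  by_cases h : w = 0
  · simp [normalizeOr, h]
  · ext1
    simp [normalizeOr, h]

lemma lintegral_uniformSphere_neg (hd : 1 ≤ d) (f : Vel d → ℝ≥0∞) (hf : Measurable f) :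
    ∫⁻ u, f (-u) ∂(uniformSphere d) = ∫⁻ u, f u ∂(uniformSphere d) := by
  obtain ⟨u₀⟩ := nonempty_vel hd
  have hneg : Measurable fun u : Vel d => -u := continuous_neg.measurable
  have hc0 : ENNReal.ofReal (d : ℝ)⁻¹ ≠ 0 := by
    rw [Ne, ENNReal.ofReal_eq_zero, not_le]
    positivity
  rw [lintegral_uniformSphere, lintegral_uniformSphere]
  congr 1
  -- The symmetry is inherited from Lebesgue measure on the ball. Taking `-u₀` as default on one
  -- side makes the integrands match at the origin as well.
  rw [← ENNReal.mul_left_inj hc0 ENNReal.ofReal_ne_top,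
    ← lintegral_ball_normalizeOr hd u₀ (fun u => f (-u)) (hf.comp hneg),
    ← lintegral_ball_normalizeOr hd (-u₀) f hf, ← lintegral_neg_eq_self]
  refine lintegral_congr fun w => ?_
  rw [← normalizeOr_neg, neg_neg]
  simp [Set.indicator]

/-- The velocity update as a map of the sphere. -/
def sphereUpdate (L : Pos d → ℝ) (ε : ℝ) (x : Pos d) (u : Vel d) : Vel d :=
  (updateB L ε (x, u)).2

/-- The Jacobian of the velocity update with respect to the uniform distribution on the sphere is
`g^{-(d-1)}`. -/
lemma lintegral_sphereUpdate (L : Pos d → ℝ) (ε : ℝ) (x : Pos d) (hd : 1 ≤ d)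
    (f : Vel d → ℝ≥0∞) (hf : Measurable f) :
    ∫⁻ u : Vel d, f (sphereUpdate L ε x u) * ENNReal.ofReal ((growth L ε x u)⁻¹ ^ (d - 1))
        ∂(uniformSphere d) =
      ∫⁻ u, f u ∂(uniformSphere d) := by
  obtain ⟨u₀⟩ := nonempty_vel hd
  rw [lintegral_uniformSphere, lintegral_uniformSphere]
  congr 1
  have hnm := measurable_normalizeOr u₀
  -- extend `f` to a function on the unit ball that is constant on rays
  let h : Pos d → ℝ≥0∞ := fun w => f (normalizeOr u₀ w) * (Metric.ball 0 1).indicator 1 w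
  have hh : Measurable h :=
    (hf.comp hnm).mul (measurable_one.indicator Metric.isOpen_ball.measurableSet)
  have hd1 : d - 1 + 1 = d := by omega
  have hbm : Measurable (boost L ε x) := by unfold boost; fun_prop
  have key := lintegral_boost L ε x hd h
  rw [lintegral_ball_normalizeOr hd u₀ f hf, lintegral_polar _ (by fun_prop) hd] at key
  -- Along the ray of `u` the boost stretches lengths by `g`, so its image lies in the ball when `r
  -- < 1 / g`. The radial integral is `g^{-d} / d`, and the Jacobian `g` of the boost turns it into
  -- `g^{-(d-1)} / d`.
  have hLft : ∀ u : Vel d, ∫⁻ r : Set.Ioi (0 : ℝ),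
      ENNReal.ofReal (‖boost L ε x (r.1 • (u : Pos d))‖ / ‖r.1 • (u : Pos d)‖) *
        h (boost L ε x (r.1 • (u : Pos d))) ∂(Measure.volumeIoiPow (d - 1)) =
      f (sphereUpdate L ε x u) * ENNReal.ofReal ((growth L ε x u)⁻¹ ^ (d - 1)) *
        ENNReal.ofReal (d : ℝ)⁻¹ := by
    intro u
    have hu : ‖(u : Pos d)‖ = 1 := norm_eq_of_mem_sphere u
    have hg := growth_pos L ε x u hu
    have : ∀ r : Set.Ioi (0 : ℝ),
        ENNReal.ofReal (‖boost L ε x (r.1 • (u : Pos d))‖ / ‖r.1 • (u : Pos d)‖) *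
          h (boost L ε x (r.1 • (u : Pos d))) =
        ENNReal.ofReal (growth L ε x u) * f (sphereUpdate L ε x u) *
          {r : Set.Ioi (0 : ℝ) | r.1 < (growth L ε x u)⁻¹}.indicator 1 r := by
      intro r
      have hr : (0 : ℝ) < r.1 := r.2
      have hb : boost L ε x (r.1 • (u : Pos d)) =
          (r.1 * growth L ε x u) • (sphereUpdate L ε x u : Pos d) := by
        rw [boost_smul _ _ _ _ hr.le, boost_of_norm_eq_one _ _ _ _ hu, smul_smul]
        rfl
      have hpos := mul_pos hr hg
      simp only [h, hb, normalizeOr_smul _ _ hpos, norm_smul, norm_eq_of_mem_sphere, Real.norm_eq_abs,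
        abs_of_pos hpos, abs_of_pos hr, mul_one, mul_div_cancel_left₀ _ hr.ne', mul_assoc]
      congr 2
      simp only [Set.indicator, Metric.mem_ball, dist_zero_right, norm_smul, Real.norm_eq_abs,
        abs_of_pos hpos, norm_eq_of_mem_sphere, mul_one, Set.mem_ofPred_eq, Pi.one_apply,
        ← lt_div_iff₀ hg, one_div]
    simp_rw [this]
    rw [lintegral_const_mul _ (measurable_one.indicator
      (measurableSet_lt measurable_subtype_coe measurable_const)),
      lintegral_volumeIoiPow_indicator hd (inv_pos.mpr hg), mul_comm (ENNReal.ofReal _),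
      mul_assoc, mul_assoc, ← ENNReal.ofReal_mul hg.le, ← ENNReal.ofReal_mul (by positivity)]
    congr 2
    have hpow : ∀ b : ℝ, b ^ d = b ^ (d - 1) * b := fun b => by rw [← pow_succ, hd1]
    rw [hpow]
    field_simp
  simp_rw [hLft] at key
  have hc0 : ENNReal.ofReal (d : ℝ)⁻¹ ≠ 0 := by
    rw [Ne, ENNReal.ofReal_eq_zero, not_le]
    positivity
  rw [lintegral_mul_const' _ _ ENNReal.ofReal_ne_top] at key
  exact (ENNReal.mul_left_inj hc0 ENNReal.ofReal_ne_top).mp key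

/-! ### Reversibility of the velocity refreshment -/

lemma lintegral_comp_affine (a : Pos d) {s : ℝ} (hs : s ≠ 0) (h : Pos d → ℝ≥0∞)
    (hh : Measurable h) :
    ∫⁻ ξ, h (a + s • ξ) = ENNReal.ofReal |(s ^ d)⁻¹| * ∫⁻ w, h w := by
  have hm := Measure.map_addHaar_smul (volume : Measure (Pos d)) hs
  rw [finrank_euclideanSpace_fin] at hm
  rw [← lintegral_add_left_eq_self h a, ← smul_eq_mul, ← lintegral_smul_measure, ← hm,
    lintegral_map (by fun_prop) (by fun_prop)]

/-- The unnormalized density, with respect to the uniform distribution on the sphere, of the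
direction of `c u + s ξ` for a standard Gaussian vector `ξ`. -/
def directionDensity (c s : ℝ) (u v : Vel d) : ℝ≥0∞ :=
  ∫⁻ r : Set.Ioi (0 : ℝ), ENNReal.ofReal ((√(2 * π))⁻¹ ^ d *
    exp (-‖s⁻¹ • (r.1 • (v : Pos d) - c • (u : Pos d))‖ ^ 2 / 2)) ∂(Measure.volumeIoiPow (d - 1))

lemma measurable_directionDensity (c s : ℝ) :
    Measurable fun p : Vel d × Vel d => directionDensity c s p.1 p.2 := by
  unfold directionDensity
  refine Measurable.lintegral_prod_right' (f := fun p : (Vel d × Vel d) × Set.Ioi (0 : ℝ) =>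
    ENNReal.ofReal ((√(2 * π))⁻¹ ^ d *
      exp (-‖s⁻¹ • (p.2.1 • (p.1.2 : Pos d) - c • (p.1.1 : Pos d))‖ ^ 2 / 2))) ?_
  fun_prop

/-- For unit vectors `‖r v - c u‖² = r² + c² - 2 r c (u · v)`, which is symmetric in `u` and `v`. -/
lemma directionDensity_comm (c s : ℝ) (u v : Vel d) :
    directionDensity c s u v = directionDensity c s v u := by
  unfold directionDensity
  refine lintegral_congr fun r => ?_
  have : ‖s⁻¹ • (r.1 • (v : Pos d) - c • (u : Pos d))‖ ^ 2 =
      ‖s⁻¹ • (r.1 • (u : Pos d) - c • (v : Pos d))‖ ^ 2 := by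
    rw [norm_smul, norm_smul, mul_pow, mul_pow, norm_sub_sq_real, norm_sub_sq_real]
    simp only [norm_smul, norm_eq_of_mem_sphere, inner_smul_left, inner_smul_right,
      real_inner_comm (u : Pos d) (v : Pos d)]
  rw [this]

/-- Substitute `w = c u + s ξ` in the Gaussian integral, then integrate `w` in polar coordinates:
only the Gaussian factor depends on the radius. -/
lemma lintegral_normalizeOr_gaussian (hd : 1 ≤ d) (c : ℝ) {s : ℝ} (hs : s ≠ 0) (u : Vel d)
    (f : Vel d → ℝ≥0∞) (hf : Measurable f) :
    ∫⁻ ξ, f (normalizeOr u (c • (u : Pos d) + s • ξ)) ∂(stdGaussian (Pos d)) =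
      ENNReal.ofReal |(s ^ d)⁻¹| *
        ∫⁻ v, directionDensity c s u v * f v ∂(volume : Measure (Pos d)).toSphere := by
  have hfn : Measurable fun w => f (normalizeOr u w) := hf.comp (measurable_normalizeOr u)
  rw [lintegral_stdGaussian (fun ξ => f (normalizeOr u (c • (u : Pos d) + s • ξ)))
    (hfn.comp (by fun_prop))]
  let G : Pos d → ℝ≥0∞ := fun w => ENNReal.ofReal ((√(2 * π))⁻¹ ^ d *
    exp (-‖s⁻¹ • (w - c • (u : Pos d))‖ ^ 2 / 2)) * f (normalizeOr u w)
  have hG : Measurable G := Measurable.mul (by fun_prop) hfn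
  have h1 : ∀ ξ : Pos d, ENNReal.ofReal ((√(2 * π))⁻¹ ^ d * exp (-‖ξ‖ ^ 2 / 2)) *
      f (normalizeOr u (c • (u : Pos d) + s • ξ)) = G (c • (u : Pos d) + s • ξ) := by
    intro ξ
    simp only [G, add_sub_cancel_left, smul_smul, inv_mul_cancel₀ hs, one_smul]
  simp_rw [h1]
  rw [lintegral_comp_affine _ hs G hG, lintegral_polar G hG hd]
  congr 1
  refine lintegral_congr fun v => ?_
  rw [directionDensity, ← lintegral_mul_const _ (by fun_prop)]
  refine lintegral_congr fun r => ?_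
  simp only [G, normalizeOr_smul u v r.2]

lemma lintegral_normalizeOr_symm (hd : 1 ≤ d) (c : ℝ) {s : ℝ} (hs : s ≠ 0)
    (F : Vel d → Vel d → ℝ≥0∞) (hF : Measurable (Function.uncurry F)) :
    ∫⁻ u, ∫⁻ ξ, F u (normalizeOr u (c • (u : Pos d) + s • ξ)) ∂(stdGaussian (Pos d))
        ∂(uniformSphere d) =
      ∫⁻ u, ∫⁻ ξ, F (normalizeOr u (c • (u : Pos d) + s • ξ)) u ∂(stdGaussian (Pos d))
        ∂(uniformSphere d) := by
  have hk := measurable_directionDensity (d := d) c s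
  rw [lintegral_uniformSphere, lintegral_uniformSphere]
  congr 1
  simp_rw [fun u => lintegral_normalizeOr_gaussian hd c hs u (F u) (by fun_prop),
    fun u => lintegral_normalizeOr_gaussian hd c hs u (fun v => F v u) (by fun_prop)]
  rw [lintegral_const_mul' _ _ ENNReal.ofReal_ne_top,
    lintegral_const_mul' _ _ ENNReal.ofReal_ne_top]
  congr 1
  rw [lintegral_lintegral_swap]
  · simp_rw [directionDensity_comm c s]
  · exact (hk.mul hF).aemeasurable

/-- Lebesgue measure times the uniform distribution on the sphere. -/
def phaseVolume (d : ℕ) : Measure (Phase d) := (volume : Measure (Pos d)).prod (uniformSphere d)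

/-- The noise is nondegenerate, so the refreshed direction has a density. -/
lemma refreshScale_pos (hd : 1 ≤ d) {ε ℓ : ℝ} (hε : 0 < ε) (hℓ : 0 < ℓ) :
    0 < √(1 - exp (-ε / ℓ) ^ 2) / √(d : ℝ) := by
  have h1 : exp (-ε / ℓ) < 1 := by
    rw [exp_lt_one_iff, neg_div]
    exact neg_neg_of_pos (div_pos hε hℓ)
  have h2 := exp_pos (-ε / ℓ)
  have hd0 : (0 : ℝ) < d := by exact_mod_cast hd
  refine div_pos (sqrt_pos.mpr ?_) (sqrt_pos.mpr hd0)
  nlinarith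

lemma lintegral_refresh_symm (hd : 1 ≤ d) {ε ℓ : ℝ} (hε : 0 < ε) (hℓ : 0 < ℓ)
    (F : Phase d → Phase d → ℝ≥0∞) (hF : Measurable (Function.uncurry F)) :
    ∫⁻ z, ∫⁻ ξ, F z (refresh ε ℓ (z, ξ)) ∂(stdGaussian (Pos d)) ∂(phaseVolume d) =
      ∫⁻ z, ∫⁻ ξ, F (refresh ε ℓ (z, ξ)) z ∂(stdGaussian (Pos d)) ∂(phaseVolume d) := by
  have := isProbabilityMeasure_uniformSphere hd
  have hr := measurable_refresh (d := d) ε ℓ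
  have m1 : Measurable fun z : Phase d =>
      ∫⁻ ξ, F z (refresh ε ℓ (z, ξ)) ∂(stdGaussian (Pos d)) :=
    Measurable.lintegral_prod_right' (f := fun p : Phase d × Pos d => F p.1 (refresh ε ℓ p))
      (by fun_prop)
  have m2 : Measurable fun z : Phase d =>
      ∫⁻ ξ, F (refresh ε ℓ (z, ξ)) z ∂(stdGaussian (Pos d)) :=
    Measurable.lintegral_prod_right' (f := fun p : Phase d × Pos d => F (refresh ε ℓ p) p.1)
      (by fun_prop)
  rw [phaseVolume, lintegral_prod _ m1.aemeasurable, lintegral_prod _ m2.aemeasurable]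
  refine lintegral_congr fun x => ?_
  exact lintegral_normalizeOr_symm hd _ (refreshScale_pos hd hε hℓ).ne'
    (fun u v => F (x, u) (x, v)) (by unfold Function.uncurry; fun_prop)

/-! ### Change of variables for the deterministic updates -/

lemma lintegral_updateA (hd : 1 ≤ d) (ε : ℝ) (h : Phase d → ℝ≥0∞) (hh : Measurable h) :
    ∫⁻ z, h (updateA ε z) ∂(phaseVolume d) = ∫⁻ z, h z ∂(phaseVolume d) := by
  have := isProbabilityMeasure_uniformSphere hd
  rw [phaseVolume, lintegral_prod_symm' (fun z => h (updateA ε z)) (hh.comp (measurable_updateA ε)),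
    lintegral_prod_symm' _ hh]
  refine lintegral_congr fun u => ?_
  exact lintegral_add_right_eq_self (fun x => h (x, u)) (ε • (u : Pos d))

lemma lintegral_timeReversal (hd : 1 ≤ d) (h : Phase d → ℝ≥0∞) (hh : Measurable h) :
    ∫⁻ z, h (timeReversal z) ∂(phaseVolume d) = ∫⁻ z, h z ∂(phaseVolume d) := by
  have := isProbabilityMeasure_uniformSphere hd
  rw [phaseVolume, lintegral_prod (fun z => h (timeReversal z))
    (hh.comp measurable_timeReversal).aemeasurable,
    lintegral_prod _ hh.aemeasurable]
  refine lintegral_congr fun x => ?_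
  exact lintegral_uniformSphere_neg hd (fun u => h (x, u)) (by fun_prop)

lemma measurable_growth (L : Pos d → ℝ) (ε : ℝ) :
    Measurable fun z : Phase d => growth L ε z.1 z.2 := by
  have hg := measurable_gradient L
  unfold growth forceStep forceDir
  fun_prop

/-- The Jacobian of the velocity update. -/
def jacobianB (L : Pos d → ℝ) (ε : ℝ) (z : Phase d) : ℝ≥0∞ :=
  ENNReal.ofReal ((growth L ε z.1 z.2)⁻¹ ^ (d - 1))

lemma measurable_jacobianB (L : Pos d → ℝ) (ε : ℝ) : Measurable (jacobianB L ε) := by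
  have := measurable_growth L ε
  unfold jacobianB
  fun_prop

lemma lintegral_updateB (hd : 1 ≤ d) (L : Pos d → ℝ) (ε : ℝ) (h : Phase d → ℝ≥0∞)
    (hh : Measurable h) :
    ∫⁻ z, h (updateB L ε z) * jacobianB L ε z ∂(phaseVolume d) = ∫⁻ z, h z ∂(phaseVolume d) := by
  have := isProbabilityMeasure_uniformSphere hd
  have hj := measurable_jacobianB L ε
  rw [phaseVolume, lintegral_prod (fun z => h (updateB L ε z) * jacobianB L ε z)
    ((hh.comp (measurable_updateB L ε)).mul hj).aemeasurable,
    lintegral_prod _ hh.aemeasurable]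
  refine lintegral_congr fun x => ?_
  exact lintegral_sphereUpdate L ε x hd (fun u => h (x, u)) (by fun_prop)

/-- The Jacobian of the deterministic step. -/
def jacobianStep (L : Pos d → ℝ) (ε : ℝ) (z : Phase d) : ℝ≥0∞ :=
  jacobianB L (ε / 2) (updateA ε (updateB L (ε / 2) z)) * jacobianB L (ε / 2) z

/-- The test function is pulled back through the last update first, so each Jacobian is evaluated
where its own update starts. -/
lemma lintegral_stepBAB (hd : 1 ≤ d) (L : Pos d → ℝ) (ε : ℝ) (h : Phase d → ℝ≥0∞)
    (hh : Measurable h) :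
    ∫⁻ z, h (stepBAB L ε z) * jacobianStep L ε z ∂(phaseVolume d) =
      ∫⁻ z, h z ∂(phaseVolume d) := by
  have hB := measurable_updateB L (ε / 2)
  have hA := measurable_updateA (d := d) ε
  have hj := measurable_jacobianB L (ε / 2)
  rw [← lintegral_updateB hd L (ε / 2) h hh,
    ← lintegral_updateA hd ε (fun z => h (updateB L (ε / 2) z) * jacobianB L (ε / 2) z)
      (by fun_prop),
    ← lintegral_updateB hd L (ε / 2) (fun z => h (updateB L (ε / 2) (updateA ε z)) *
      jacobianB L (ε / 2) (updateA ε z)) (by fun_prop)]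
  simp only [stepBAB, jacobianStep, Function.comp_apply, mul_assoc]

/-! ### Time reversal -/

lemma timeReversal_timeReversal (z : Phase d) : timeReversal (timeReversal z) = z := by
  simp [timeReversal]

lemma updateA_timeReversal_updateA (ε : ℝ) (z : Phase d) :
    updateA ε (timeReversal (updateA ε z)) = timeReversal z := by
  simp [updateA, timeReversal]

/-- Conjugation by time reversal turns `B_ε` into `B_{-ε}`, its inverse. -/
lemma updateB_timeReversal_updateB (L : Pos d → ℝ) (ε : ℝ) (z : Phase d) :
    updateB L ε (timeReversal (updateB L ε z)) = timeReversal z := by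
  refine Prod.ext rfl (Subtype.ext ?_)
  change velocityUpdate L ε z.1 (-velocityUpdate L ε z.1 z.2) = -(z.2 : Pos d)
  rw [velocityUpdate_neg, velocityUpdate_neg_velocityUpdate _ _ _ _ (norm_eq_of_mem_sphere z.2)]

/-- The composition is palindromic, so the reversals of its updates telescope from the inside out.
-/
lemma stepBAB_timeReversal_stepBAB (L : Pos d → ℝ) (ε : ℝ) (z : Phase d) :
    stepBAB L ε (timeReversal (stepBAB L ε z)) = timeReversal z := by
  simp only [stepBAB, Function.comp_apply, updateB_timeReversal_updateB,
    updateA_timeReversal_updateA]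

/-- Since the Gaussian is symmetric, this makes `𝒯` and `O` commute in law. -/
lemma timeReversal_refresh (ε ℓ : ℝ) (z : Phase d) (ξ : Pos d) :
    timeReversal (refresh ε ℓ (z, ξ)) = refresh ε ℓ (timeReversal z, -ξ) := by
  refine Prod.ext rfl ?_
  simp only [timeReversal, refresh]
  rw [← normalizeOr_neg]
  congr 1
  simp
  abel

/-! ### The energy error as a function of the initial and final positions -/

lemma fst_stepBAB (L : Pos d → ℝ) (ε : ℝ) (x : Pos d) (v : Vel d) :
    (stepBAB L ε (x, v)).1 = x + ε • (sphereUpdate L (ε / 2) x v : Pos d) := rfl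

lemma sphereUpdate_neg_sphereUpdate (L : Pos d → ℝ) (ε : ℝ) (x : Pos d) (v : Vel d) :
    sphereUpdate L (-ε) x (sphereUpdate L ε x v) = v :=
  Subtype.ext (velocityUpdate_neg_velocityUpdate L ε x v (norm_eq_of_mem_sphere v))

lemma energyError_stepBAB (L : Pos d → ℝ) {ε : ℝ} (hε : 0 < ε) (x : Pos d) (u v w : Vel d) :
    energyError L ε ((stepBAB L ε (x, v)).1, w) (x, u) = stepEnergyError L ε (x, v) := by
  have h : ∃ v' : Vel d, (stepBAB L ε (((x, u) : Phase d).1, v')).1 =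
      ((stepBAB L ε (x, v)).1, w).1 := ⟨v, rfl⟩
  rw [energyError, dif_pos h]
  have hs := h.choose_spec
  generalize h.choose = v' at hs ⊢
  simp only [fst_stepBAB, add_right_inj] at hs
  -- Equal displacements force equal velocities after the first half step; inverting that half step
  -- identifies the chosen `v'` with `v`.
  have h2 := Subtype.ext (smul_right_injective (Pos d) hε.ne' hs)
  have h3 := congrArg (sphereUpdate L (-(ε / 2)) x) h2
  rw [sphereUpdate_neg_sphereUpdate, sphereUpdate_neg_sphereUpdate] at h3
  rw [h3]

/-- An explicit formula replacing the choice in `energyError`, needed for measurability. The default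
`u₀` plays no role, since `‖x' - x‖ = ε > 0` in the first branch. -/
lemma energyError_eq_ite (L : Pos d → ℝ) {ε : ℝ} (hε : 0 < ε) (u₀ : Vel d) (z' z : Phase d) :
    energyError L ε z' z = if ‖z'.1 - z.1‖ = ε then
      stepEnergyError L ε (z.1, sphereUpdate L (-(ε / 2)) z.1 (normalizeOr u₀ (z'.1 - z.1)))
      else 0 := by
  obtain ⟨x', u'⟩ := z'
  obtain ⟨x, u⟩ := z
  simp only
  split_ifs with h
  · have hx : x' - x ≠ 0 := by
      rw [← norm_ne_zero_iff, h]; exact hε.ne'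
    set v := sphereUpdate L (-(ε / 2)) x (normalizeOr u₀ (x' - x)) with hv
    have hx' : (stepBAB L ε (x, v)).1 = x' := by
      have := sphereUpdate_neg_sphereUpdate L (-(ε / 2)) x (normalizeOr u₀ (x' - x))
      rw [neg_neg, ← hv] at this
      rw [fst_stepBAB, this, normalizeOr, dif_neg hx]
      simp [h, smul_smul, hε.ne']
    rw [← energyError_stepBAB L hε x u v u', hx']
  · rw [energyError, dif_neg]
    rintro ⟨v, hv⟩
    apply h
    simp only [fst_stepBAB] at hv
    rw [← hv, add_sub_cancel_left, norm_smul, norm_eq_of_mem_sphere, mul_one, Real.norm_eq_abs,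
      abs_of_pos hε]

lemma measurable_targetDensity {L : Pos d → ℝ} (hL : Measurable L) :
    Measurable (targetDensity L) := by
  unfold targetDensity
  fun_prop

lemma measurable_stepEnergyError {L : Pos d → ℝ} (hL : Measurable L) (ε : ℝ) :
    Measurable (stepEnergyError L ε) := by
  have h1 := measurable_targetDensity hL
  have h2 := measurable_growth L (ε / 2)
  have hB := measurable_updateB L (ε / 2)
  have hA := measurable_updateA (d := d) ε
  have hK : Measurable (deltaK L (ε / 2)) := (measurable_log.comp h2).const_mul _
  have hV : Measurable (deltaV L ε) := by
    unfold deltaV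
    fun_prop
  unfold stepEnergyError
  fun_prop

lemma measurable_energyError (hd : 1 ≤ d) {L : Pos d → ℝ} (hL : Measurable L) {ε : ℝ}
    (hε : 0 < ε) : Measurable fun zz : Phase d × Phase d => energyError L ε zz.2 zz.1 := by
  obtain ⟨u₀⟩ := nonempty_vel hd
  simp_rw [energyError_eq_ite L hε u₀]
  have hn := measurable_normalizeOr u₀
  have hB := measurable_updateB L (-(ε / 2))
  have hs := measurable_stepEnergyError hL ε
  refine Measurable.ite (measurableSet_eq_fun (by fun_prop) measurable_const) ?_ measurable_const
  refine hs.comp (Measurable.prodMk (by fun_prop) ?_)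
  exact measurable_snd.comp (hB.comp (g := updateB L (-(ε / 2)))
    (f := fun zz : Phase d × Phase d => (zz.1.1, normalizeOr u₀ (zz.2.1 - zz.1.1))) (by fun_prop))

/-! ### Forward and backward laws -/

lemma targetDensity_pos {L : Pos d → ℝ} (hint : Integrable fun x => exp (-L x)) (x : Pos d) :
    0 < targetDensity L x := div_pos (exp_pos _) (integral_exp_pos hint)

lemma exp_neg_mul_log {g : ℝ} (hg : 0 < g) (hd : 1 ≤ d) :
    exp (-(((d : ℝ) - 1) * log g)) = g⁻¹ ^ (d - 1) := by
  rw [← mul_neg, ← log_inv, ← Nat.cast_pred hd, exp_nat_mul, exp_log (inv_pos.mpr hg)]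

/-- Each kinetic term exponentiates to a Jacobian `g^{-(d-1)}`, and the potential term to a ratio of
densities whose denominator cancels. -/
lemma targetDensity_mul_exp_neg_stepEnergyError (hd : 1 ≤ d) {L : Pos d → ℝ}
    (hint : Integrable fun x => exp (-L x)) (ε : ℝ) (z : Phase d) :
    ENNReal.ofReal (targetDensity L z.1) * ENNReal.ofReal (exp (-stepEnergyError L ε z)) =
      ENNReal.ofReal (targetDensity L (stepBAB L ε z).1) * jacobianStep L ε z := by
  have hp := targetDensity_pos hint
  have hg : ∀ z : Phase d, 0 < growth L (ε / 2) z.1 z.2 :=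
    fun z => growth_pos L _ _ _ (norm_eq_of_mem_sphere z.2)
  have hV : exp (-deltaV L ε (updateB L (ε / 2) z)) =
      targetDensity L (stepBAB L ε z).1 / targetDensity L z.1 := by
    rw [deltaV, neg_neg, exp_log (div_pos (hp _) (hp _))]
    rfl
  have hexp : exp (-stepEnergyError L ε z) =
      (growth L (ε / 2) z.1 z.2)⁻¹ ^ (d - 1) *
        (targetDensity L (stepBAB L ε z).1 / targetDensity L z.1) *
        (growth L (ε / 2) (updateA ε (updateB L (ε / 2) z)).1
          (updateA ε (updateB L (ε / 2) z)).2)⁻¹ ^ (d - 1) := by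
    rw [stepEnergyError, neg_add, neg_add, exp_add, exp_add, hV, deltaK, deltaK,
      exp_neg_mul_log (hg _) hd, exp_neg_mul_log (hg _) hd]
  have h1 := (hg z).le
  have h2 := (hg (updateA ε (updateB L (ε / 2) z))).le
  rw [jacobianStep, jacobianB, jacobianB, ← ENNReal.ofReal_mul (pow_nonneg (inv_nonneg.mpr h2) _),
    ← ENNReal.ofReal_mul (hp _).le, ← ENNReal.ofReal_mul (hp _).le, hexp]
  congr 1
  field_simp [(hp z.1).ne']

lemma lintegral_phaseTarget (hd : 1 ≤ d) {L : Pos d → ℝ} (hL : Measurable L)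
    (h : Phase d → ℝ≥0∞) (hh : Measurable h) :
    ∫⁻ z, h z ∂(phaseTarget L) =
      ∫⁻ z, ENNReal.ofReal (targetDensity L z.1) * h z ∂(phaseVolume d) := by
  have := isProbabilityMeasure_uniformSphere hd
  have hp := measurable_targetDensity hL
  rw [phaseTarget, prod_withDensity_left (by fun_prop),
    lintegral_withDensity_eq_lintegral_mul _ (by fun_prop) hh]
  rfl

lemma lintegral_refreshKernel (ε ℓ : ℝ) (z : Phase d) (f : Phase d → ℝ≥0∞) (hf : Measurable f) :
    ∫⁻ z', f z' ∂(refreshKernel d ε ℓ z) = ∫⁻ ξ, f (refresh ε ℓ (z, ξ)) ∂(stdGaussian (Pos d)) := by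
  have hr := measurable_refresh (d := d) ε ℓ
  rw [refreshKernel, Kernel.lintegral_map _ hr _ hf,
    Kernel.lintegral_id_prod (f := fun p => f (refresh ε ℓ p)) (by fun_prop), Kernel.const_apply]

lemma lintegral_proposal (L : Pos d → ℝ) (ε ℓ : ℝ) (z : Phase d) (f : Phase d → ℝ≥0∞)
    (hf : Measurable f) :
    ∫⁻ z', f z' ∂(proposal L ε ℓ z) =
      ∫⁻ ξ, ∫⁻ ζ, f (timeReversal (refresh ε ℓ (stepBAB L ε (refresh ε ℓ (z, ξ)), ζ)))
        ∂(stdGaussian (Pos d)) ∂(stdGaussian (Pos d)) := by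
  have hT := measurable_timeReversal (d := d)
  have hS := measurable_stepBAB L ε
  have hfT : Measurable fun z => f (timeReversal z) := hf.comp hT
  have hK : Measurable fun z => ∫⁻ z', f (timeReversal z') ∂(refreshKernel d ε ℓ z) :=
    hfT.lintegral_kernel
  rw [proposal, Kernel.lintegral_comp _ _ _ hf]
  simp_rw [Kernel.lintegral_deterministic' hT hf]
  rw [Kernel.lintegral_comp _ _ _ hfT, Kernel.lintegral_comp _ _ _ hK]
  simp_rw [Kernel.lintegral_deterministic' hS hK]
  rw [lintegral_refreshKernel _ _ _ (fun z => ∫⁻ z', f (timeReversal z')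
    ∂(refreshKernel d ε ℓ (stepBAB L ε z))) (hK.comp hS)]
  simp_rw [lintegral_refreshKernel _ _ _ _ hfT]

lemma lintegral_forwardLaw (hd : 1 ≤ d) {L : Pos d → ℝ} (hL : Measurable L)
    (hint : Integrable fun x => exp (-L x)) {ε ℓ : ℝ} (hε : 0 < ε) (hℓ : 0 < ℓ)
    (F : Phase d × Phase d → ℝ≥0∞) (hF : Measurable F) :
    ∫⁻ zz, F zz ∂(forwardLaw (phaseTarget L) (proposal L ε ℓ)) =
      ∫⁻ v, ENNReal.ofReal (targetDensity L v.1) *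
        ∫⁻ ξ, ∫⁻ ζ, F (refresh ε ℓ (v, ξ), timeReversal (refresh ε ℓ (stepBAB L ε v, ζ)))
          ∂(stdGaussian (Pos d)) ∂(stdGaussian (Pos d)) ∂(phaseVolume d) := by
  have := isProbabilityMeasure_phaseTarget hd L hint
  have hT := measurable_timeReversal (d := d)
  have hS := measurable_stepBAB L ε
  have hr := measurable_refresh (d := d) ε ℓ
  have hp := measurable_targetDensity hL
  -- The target density may be evaluated after the first refreshment, which fixes the position.
  let G : Phase d → Phase d → ℝ≥0∞ := fun z v => ENNReal.ofReal (targetDensity L v.1) *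
    ∫⁻ ζ, F (z, timeReversal (refresh ε ℓ (stepBAB L ε v, ζ))) ∂(stdGaussian (Pos d))
  have hG : Measurable (Function.uncurry G) := by
    refine Measurable.mul (f := fun p : Phase d × Phase d =>
      ENNReal.ofReal (targetDensity L p.2.1)) (by fun_prop) ?_
    exact Measurable.lintegral_prod_right' (f := fun q : (Phase d × Phase d) × Pos d =>
      F (q.1.1, timeReversal (refresh ε ℓ (stepBAB L ε q.1.2, q.2)))) (by fun_prop)
  rw [forwardLaw, Measure.lintegral_compProd hF,
    lintegral_phaseTarget hd hL _ hF.lintegral_kernel_prod_right']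
  simp_rw [fun z => lintegral_proposal L ε ℓ z (fun z' => F (z, z')) (by fun_prop)]
  calc _ = ∫⁻ z, ∫⁻ ξ, G z (refresh ε ℓ (z, ξ)) ∂(stdGaussian (Pos d)) ∂(phaseVolume d) :=
        lintegral_congr fun z => (lintegral_const_mul' _ _ ENNReal.ofReal_ne_top).symm
    _ = ∫⁻ v, ∫⁻ ξ, G (refresh ε ℓ (v, ξ)) v ∂(stdGaussian (Pos d)) ∂(phaseVolume d) :=
        lintegral_refresh_symm hd hε hℓ G hG
    _ = _ := lintegral_congr fun v => lintegral_const_mul' _ _ ENNReal.ofReal_ne_top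

/-- The backward law has density `exp (-Δ)` with respect to the forward law. -/
lemma lintegral_backwardLaw (hd : 1 ≤ d) {L : Pos d → ℝ} (hL : Measurable L)
    (hint : Integrable fun x => exp (-L x)) {ε ℓ : ℝ} (hε : 0 < ε) (hℓ : 0 < ℓ)
    (F : Phase d × Phase d → ℝ≥0∞) (hF : Measurable F) :
    ∫⁻ zz, F zz ∂(backwardLaw (phaseTarget L) (proposal L ε ℓ)) =
      ∫⁻ zz, ENNReal.ofReal (exp (-energyError L ε zz.2 zz.1)) * F zz
        ∂(forwardLaw (phaseTarget L) (proposal L ε ℓ)) := by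
  have := isProbabilityMeasure_phaseTarget hd L hint
  have hT := measurable_timeReversal (d := d)
  have hS := measurable_stepBAB L ε
  have hr := measurable_refresh (d := d) ε ℓ
  have hp := measurable_targetDensity hL
  have hE := measurable_energyError hd hL hε
  rw [backwardLaw, lintegral_map hF measurable_swap]
  have hfw := lintegral_forwardLaw hd hL hint hε hℓ (fun zz => F zz.swap) (by fun_prop)
  rw [forwardLaw] at hfw
  rw [hfw, lintegral_forwardLaw hd hL hint hε hℓ _ (by fun_prop)]
  simp only [Prod.swap_prod_mk]
  let K : Phase d → ℝ≥0∞ := fun v => ENNReal.ofReal (targetDensity L v.1) *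
    ∫⁻ ξ, ∫⁻ ζ, F (timeReversal (refresh ε ℓ (stepBAB L ε v, ζ)), refresh ε ℓ (v, ξ))
      ∂(stdGaussian (Pos d)) ∂(stdGaussian (Pos d))
  have hK : Measurable K := by
    refine Measurable.mul (by fun_prop) ?_
    refine Measurable.lintegral_prod_right' (f := fun q : Phase d × Pos d =>
      ∫⁻ ζ, F (timeReversal (refresh ε ℓ (stepBAB L ε q.1, ζ)), refresh ε ℓ q)
        ∂(stdGaussian (Pos d))) ?_
    exact Measurable.lintegral_prod_right' (f := fun q : (Phase d × Pos d) × Pos d =>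
      F (timeReversal (refresh ε ℓ (stepBAB L ε q.1.1, q.2)), refresh ε ℓ q.1)) (by fun_prop)
  change ∫⁻ v, K v ∂(phaseVolume d) = _
  -- This is the substitution `v ↦ 𝒯 Φ v`, contributing the Jacobian of `Φ`.
  rw [← lintegral_timeReversal hd K hK,
    ← lintegral_stepBAB hd L ε (fun z => K (timeReversal z)) (by fun_prop)]
  refine lintegral_congr fun v => ?_
  have hrT : ∀ (w : Phase d) (ξ : Pos d),
      refresh ε ℓ (timeReversal w, ξ) = timeReversal (refresh ε ℓ (w, -ξ)) := fun w ξ => by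
    rw [timeReversal_refresh, neg_neg]
  have hΔ : ∀ ξ ζ : Pos d, energyError L ε (timeReversal (refresh ε ℓ (stepBAB L ε v, ζ)))
      (refresh ε ℓ (v, ξ)) = stepEnergyError L ε v :=
    fun ξ ζ => energyError_stepBAB L hε v.1 _ v.2 _
  let F' : Pos d → Pos d → ℝ≥0∞ := fun ξ ζ =>
    F (refresh ε ℓ (v, ξ), timeReversal (refresh ε ℓ (stepBAB L ε v, ζ)))
  have hF' : Measurable (Function.uncurry F') := by
    unfold Function.uncurry
    fun_prop
  have hKv : K (timeReversal (stepBAB L ε v)) =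
      ENNReal.ofReal (targetDensity L (stepBAB L ε v).1) *
        ∫⁻ ξ, ∫⁻ ζ, F' ξ ζ ∂(stdGaussian (Pos d)) ∂(stdGaussian (Pos d)) := by
    -- Reversibility of `Φ` swaps the two ends of the pair, so `ξ` and `ζ` trade places with flipped
    -- signs; Gaussian symmetry and Tonelli restore the original order.
    simp only [K, stepBAB_timeReversal_stepBAB, hrT, timeReversal_timeReversal]
    congr 1
    calc _ = ∫⁻ ξ, ∫⁻ ζ, F' ζ (-ξ) ∂(stdGaussian (Pos d)) ∂(stdGaussian (Pos d)) :=
          lintegral_congr fun ξ => lintegral_stdGaussian_neg (fun ζ => F' ζ (-ξ)) (by fun_prop)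
      _ = ∫⁻ ζ, ∫⁻ ξ, F' ζ (-ξ) ∂(stdGaussian (Pos d)) ∂(stdGaussian (Pos d)) :=
          lintegral_lintegral_swap (by unfold Function.uncurry; fun_prop)
      _ = _ := lintegral_congr fun ζ => lintegral_stdGaussian_neg (F' ζ) (by fun_prop)
  simp only [hΔ]
  simp_rw [lintegral_const_mul' _ _ ENNReal.ofReal_ne_top]
  rw [hKv, ← mul_assoc, targetDensity_mul_exp_neg_stepEnergyError hd hint]
  ring

lemma backwardLaw_eq_withDensity (hd : 1 ≤ d) {L : Pos d → ℝ} (hL : Measurable L)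
    (hint : Integrable fun x => exp (-L x)) {ε ℓ : ℝ} (hε : 0 < ε) (hℓ : 0 < ℓ) :
    backwardLaw (phaseTarget L) (proposal L ε ℓ) =
      (forwardLaw (phaseTarget L) (proposal L ε ℓ)).withDensity
        fun zz => ENNReal.ofReal (exp (-energyError L ε zz.2 zz.1)) := by
  have hE := measurable_energyError hd hL hε
  refine Measure.ext_of_lintegral _ fun F hF => ?_
  rw [lintegral_backwardLaw hd hL hint hε hℓ F hF,
    lintegral_withDensity_eq_lintegral_mul _ (by fun_prop) hF]
  rfl

end MAMS

end

/-! ### The Metropolis–Hastings ratio as a Radon–Nikodym derivative -/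

theorem theorem1 (d : ℕ) (hd : 2 ≤ d) (L : EuclideanSpace ℝ (Fin d) → ℝ)
    (hL : Differentiable ℝ L) (hint : Integrable (fun x => Real.exp (-L x)))
    (ε ℓ : ℝ) (hε : 0 < ε) (hℓ : 0 < ℓ) :
    -- `Δ` only sees the deterministic step: if the first `O` update changes the velocity `u` to
    -- `v`, and the final `O` and `𝒯` updates end in the velocity `w`, then `Δ` is the energy error
    -- of the step `B ∘ A ∘ B` started from `(x, v)`, whatever `u` and `w` are
    (∀ (x : MAMS.Pos d) (u v w : MAMS.Vel d),
      MAMS.energyError L ε ((MAMS.stepBAB L ε (x, v)).1, w) (x, u) =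
        MAMS.stepEnergyError L ε (x, v)) ∧
    -- forward and backward law have the same null sets
    MAMS.backwardLaw (MAMS.phaseTarget L) (MAMS.proposal L ε ℓ) ≪
      MAMS.forwardLaw (MAMS.phaseTarget L) (MAMS.proposal L ε ℓ) ∧
    MAMS.forwardLaw (MAMS.phaseTarget L) (MAMS.proposal L ε ℓ) ≪
      MAMS.backwardLaw (MAMS.phaseTarget L) (MAMS.proposal L ε ℓ) ∧
    -- the Metropolis–Hastings ratio is `exp(-Δ(z', z))`
    (∀ᵐ zz ∂(MAMS.forwardLaw (MAMS.phaseTarget L) (MAMS.proposal L ε ℓ)),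
      MAMS.mhRatio (MAMS.phaseTarget L) (MAMS.proposal L ε ℓ) zz.2 zz.1 =
        ENNReal.ofReal (Real.exp (-MAMS.energyError L ε zz.2 zz.1))) ∧
    -- the acceptance probability is `min(1, exp(-Δ(z', z)))`
    (∀ᵐ zz ∂(MAMS.forwardLaw (MAMS.phaseTarget L) (MAMS.proposal L ε ℓ)),
      MAMS.acceptProb (MAMS.phaseTarget L) (MAMS.proposal L ε ℓ) zz.2 zz.1 =
        ENNReal.ofReal (min 1 (Real.exp (-MAMS.energyError L ε zz.2 zz.1)))) := by
  have hd1 : 1 ≤ d := by omega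
  have hLm : Measurable L := hL.continuous.measurable
  have hE := MAMS.measurable_energyError hd1 hLm hε
  have := MAMS.isProbabilityMeasure_phaseTarget hd1 L hint
  have hdens := MAMS.backwardLaw_eq_withDensity hd1 hLm hint hε hℓ
  have hfin : SigmaFinite (MAMS.forwardLaw (MAMS.phaseTarget L) (MAMS.proposal L ε ℓ)) := by
    unfold MAMS.forwardLaw
    infer_instance
  have hmeas : Measurable fun zz : MAMS.Phase d × MAMS.Phase d =>
      ENNReal.ofReal (Real.exp (-MAMS.energyError L ε zz.2 zz.1)) := by fun_prop
  have hratio : ∀ᵐ zz ∂(MAMS.forwardLaw (MAMS.phaseTarget L) (MAMS.proposal L ε ℓ)),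
      MAMS.mhRatio (MAMS.phaseTarget L) (MAMS.proposal L ε ℓ) zz.2 zz.1 =
        ENNReal.ofReal (Real.exp (-MAMS.energyError L ε zz.2 zz.1)) := by
    have h := Measure.rnDeriv_withDensity
      (MAMS.forwardLaw (MAMS.phaseTarget L) (MAMS.proposal L ε ℓ)) hmeas
    rw [← hdens] at h
    exact h
  refine ⟨fun x u v w => MAMS.energyError_stepBAB L hε x u v w, ?_, ?_, hratio, ?_⟩
  · rw [hdens]
    exact withDensity_absolutelyContinuous _ _
  · rw [hdens]
    -- The density `exp(-Δ)` vanishes nowhere, so the backward law loses no mass of the forward law.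
    refine withDensity_absolutelyContinuous' hmeas.aemeasurable (Filter.Eventually.of_forall ?_)
    intro zz
    rw [Ne, ENNReal.ofReal_eq_zero, not_le]
    exact Real.exp_pos _
  · filter_upwards [hratio] with zz h
    rw [MAMS.acceptProb, h, ENNReal.ofReal_min, ENNReal.ofReal_one]
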